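/- Let $\mathcal A$ be an abelian length category, i.e. an abelian category in which every object $X$ has a finite composition series (of length $\ell(X)$) and the isomorphism classes of objects form a set. Let $\operatorname{ind}\mathcal A$ be the set of isomorphism classes of indecomposable objects, ordered by $X\subseteq Y$ iff there is a monomorphism $X\to Y$. Order the finite subsets of $\mathbb N=\{1,2,3,\dots\}$ lexicographically: $A\le B$ iff $\min(B\setminus A)\le\min(A\setminus B)$, where $\min\emptyset$ exceeds every number. The Gabriel–Roiter measure of $X\in\operatorname{ind}\mathcal A$ is $$\mu(X)=\max\{\,\{\ell(X_1),\dots,\ell(X_r)\} : X_1\subset\dots\subset X_r=X \text{ a finite chain in } \operatorname{ind}\mathcal A\,\}.$$ Suppose that $\operatorname{ind}\mathcal A$ is infinite, that $\mathcal A$ has only finitely many isomorphism classes of simple objects, and that every indecomposable object $X$ admits a left almost split map, i.e. a map $\varphi\colon X\to Y$ that is not a split monomorphism and through which every map $X\to Y'$ that is not a split monomorphism factors. Then there exist infinitely many values $\mu(X_1)<\mu(X_2)<\mu(X_3)<\cdots$ of the Gabriel–Roiter measure, with $X_i\in\operatorname{ind}\mathcal A$, such that: 1. if $X\in\operatorname{ind}\mathcal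 A$ and $\mu(X)\neq\mu(X_i)$ for all $i$, then $\mu(X_i)<\mu(X)$ for all $i$; 2. the set $\{X\in\operatorname{ind}\mathcal A\mid\mu(X)=\mu(X_i)\}$ is finite for all $i$. -/

import Mathlib

open CategoryTheory CategoryTheory.Limits

universe v u

namespace GabrielRoiter

/-! ### The lexicographic order on finite sets of natural numbers -/

/-- `Ch(ℕ)`: the finite chains in `ℕ`, i.e. the finite sets of natural numbers. (A type of its own,
since `Finset ℕ` is already ordered by inclusion.) -/
structure NatChain where
  /-- the underlying finite set -/
  toFinset : Finset ℕ

namespace NatChain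

@[ext]
theorem ext {X Y : NatChain} (h : X.toFinset = Y.toFinset) : X = Y := by
  cases X; cases Y; cases h; rfl

/-- The lexicographic order: `X ≤ Y` iff `min (Y \ X) ≤ min (X \ Y)`, where `min ∅ = ⊤` exceeds
every natural number. -/
instance : LE NatChain where
  le X Y := (Y.toFinset \ X.toFinset).min ≤ (X.toFinset \ Y.toFinset).min

theorem le_def {X Y : NatChain} :
    X ≤ Y ↔ (Y.toFinset \ X.toFinset).min ≤ (X.toFinset \ Y.toFinset).min :=
  Iff.rfl

theorem le_iff {X Y : NatChain} :
    X ≤ Y ↔ ∀ a ∈ X.toFinset, a ∉ Y.toFinset →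
      ∃ b ∈ Y.toFinset, b ∉ X.toFinset ∧ b ≤ a := by
  rw [le_def, Finset.le_min_iff]
  constructor
  · intro h a ha ha'
    have h1 := h a (Finset.mem_sdiff.2 ⟨ha, ha'⟩)
    have hne : (Y.toFinset \ X.toFinset).Nonempty := by
      by_contra he
      rw [Finset.not_nonempty_iff_eq_empty.1 he] at h1
      simp at h1
    obtain ⟨b, hb⟩ := Finset.min_of_nonempty hne
    have hb' := Finset.mem_sdiff.1 (Finset.mem_of_min hb)
    rw [hb] at h1
    exact ⟨b, hb'.1, hb'.2, by exact_mod_cast h1⟩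
  · intro h a ha
    obtain ⟨b, hb, hb', hba⟩ := h a (Finset.mem_sdiff.1 ha).1 (Finset.mem_sdiff.1 ha).2
    exact (Finset.min_le (Finset.mem_sdiff.2 ⟨hb, hb'⟩)).trans (by exact_mod_cast hba)

/-- Auxiliary comparison with a linear order of Mathlib, used only to prove the order axioms. -/
def toColexDual (X : NatChain) : Colex (Finset ℕᵒᵈ) :=
  toColex (X.toFinset.map OrderDual.toDual.toEmbedding)

theorem le_iff_toColexDual {X Y : NatChain} : X ≤ Y ↔ X.toColexDual ≤ Y.toColexDual := by
  rw [le_iff, Finset.Colex.le_def]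
  simp [toColexDual, OrderDual.forall, OrderDual.exists]

theorem toColexDual_injective : Function.Injective toColexDual := by
  intro X Y h
  exact ext (Finset.map_injective _ (toColex.injective h))

/-- `Ch(ℕ)` is totally ordered by the lexicographic order. -/
noncomputable instance : LinearOrder NatChain where
  le_refl X := by
    rw [le_iff_toColexDual]
  le_trans X Y Z h₁ h₂ := by
    rw [le_iff_toColexDual] at *
    exact h₁.trans h₂
  le_antisymm X Y h₁ h₂ := by
    rw [le_iff_toColexDual] at *
    exact toColexDual_injective (le_antisymm h₁ h₂)
  le_total X Y := by
    simp only [le_iff_toColexDual]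
    exact le_total _ _
  toDecidableLE := Classical.decRel _

end NatChain

/-! ### The chain length function -/

/-- `Ch(S, x)`: the finite chains in `S` with maximal element `x`. -/
def chainsWithMax {S : Type*} [Preorder S] (x : S) : Set (Finset S) :=
  {X | IsChain (· ≤ ·) (X : Set S) ∧ IsGreatest (X : Set S) x}

/-- The sets `l(X)`, for `X ∈ Ch(S, x)`. -/
def chainValues {S : Type*} [Preorder S] (l : S → ℕ) (x : S) : Set NatChain :=
  {c | ∃ X ∈ chainsWithMax x, c = ⟨X.image l⟩}

open Classical in
/-- The chain length function `l^*(x) = max {l(X) | X ∈ Ch(S, x)}` induced by `l`. If `S` is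
partially ordered and `l` is strictly increasing, then `chainValues l x` is a finite non-empty set,
so that the maximum exists; the value `∅` in the other case is only there to make the function
total. -/
noncomputable def chainLength {S : Type*} [Preorder S] (l : S → ℕ) (x : S) : NatChain :=
  if h : ∃ c, IsGreatest (chainValues l x) c then h.choose else ⟨∅⟩

/-! ### Length categories -/

section Abelian

variable {C : Type u} [Category.{v} C] [Abelian C]

/-- `0 = X₀ ⊆ X₁ ⊆ ⋯ ⊆ Xₙ = X` is a composition series: each `Xᵢ₊₁ / Xᵢ` is simple. -/
def IsCompositionSeries {X : C} {n : ℕ} (s : Fin (n + 1) → Subobject X) : Prop :=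
  s 0 = ⊥ ∧ s (Fin.last n) = ⊤ ∧
    ∀ i : Fin n, ∃ h : s i.castSucc ≤ s i.succ, Simple (cokernel (Subobject.ofLE _ _ h))

/-- `X` has a composition series of length `n`. -/
def HasCompositionSeries (X : C) (n : ℕ) : Prop :=
  ∃ s : Fin (n + 1) → Subobject X, IsCompositionSeries s

/-- `X` has finite length: it has a finite composition series. -/
def HasFiniteLength (X : C) : Prop :=
  ∃ n, HasCompositionSeries X n

/-- The length of an object of finite length: the length of its composition series. They all have
the same length by the Jordan–Hölder theorem, so that the infimum is over a one-element set. -/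
noncomputable def length (X : C) : ℕ :=
  sInf {n | HasCompositionSeries X n}

theorem HasCompositionSeries.of_iso {X Y : C} (e : X ≅ Y) {n : ℕ}
    (h : HasCompositionSeries X n) : HasCompositionSeries Y n := by
  obtain ⟨s, h0, h1, h2⟩ := h
  let o := Subobject.mapIsoToOrderIso e
  refine ⟨fun i => o (s i), by simp [h0], by simp [h1], fun i => ?_⟩
  obtain ⟨h, hs⟩ := h2 i
  refine ⟨o.monotone h, ?_⟩
  have key : ∀ A : Subobject X, ∃ a : (A : C) ≅ ((o A : Subobject Y) : C),
      a.hom ≫ (o A).arrow = A.arrow ≫ e.hom := by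
    intro A
    have hA : o A = Subobject.mk (A.arrow ≫ e.hom) := by
      conv_lhs => rw [← Subobject.mk_arrow A]
      exact Subobject.map_mk _ _
    rw [hA]
    exact ⟨(Subobject.underlyingIso _).symm, by simp⟩
  obtain ⟨a, ha⟩ := key (s i.castSucc)
  obtain ⟨b, hb⟩ := key (s i.succ)
  have comm : Subobject.ofLE _ _ h ≫ b.hom = a.hom ≫ Subobject.ofLE _ _ (o.monotone h) := by
    rw [← cancel_mono (o (s i.succ)).arrow]
    simp [ha, hb]
  exact Simple.of_iso (cokernel.mapIso _ _ a b comm).symm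

theorem length_eq_of_iso {X Y : C} (e : X ≅ Y) : length X = length Y := by
  unfold length
  congr 1
  ext n
  exact ⟨fun h => h.of_iso e, fun h => h.of_iso e.symm⟩

variable (C) in
/-- An abelian category is a length category if all objects have finite length. (That the
isomorphism classes of objects form a set holds for every category of the type theory, as its
objects are the elements of a type.) -/
def IsLengthCategory : Prop :=
  ∀ X : C, HasFiniteLength X

variable (C) in
/-- `ind C`: the isomorphism classes of the indecomposable objects of `C`. -/
def Ind : Type u :=
  Quotient ((isIsomorphicSetoid C).comap (Subtype.val : {X : C // Indecomposable X} → C))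

/-- The class in `ind C` of an indecomposable object. -/
def Ind.mk (X : C) (hX : Indecomposable X) : Ind C :=
  Quotient.mk _ ⟨X, hX⟩

/-- The subobject relation on isomorphism classes: `X ≤ Y` iff there is a monomorphism `X ⟶ Y`.
In a length category it is a partial order. -/
instance : Preorder (Ind C) where
  le := Quotient.lift₂ (fun X Y => ∃ f : X.1 ⟶ Y.1, Mono f) (by
    rintro X Y X' Y' ⟨e⟩ ⟨e'⟩
    refine propext ⟨?_, ?_⟩
    · rintro ⟨f, hf⟩
      exact ⟨e.inv ≫ f ≫ e'.hom, inferInstance⟩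
    · rintro ⟨f, hf⟩
      exact ⟨e.hom ≫ f ≫ e'.inv, inferInstance⟩)
  le_refl := by
    rintro ⟨X⟩
    exact ⟨𝟙 _, inferInstance⟩
  le_trans := by
    rintro ⟨X⟩ ⟨Y⟩ ⟨Z⟩ ⟨f, hf⟩ ⟨g, hg⟩
    exact ⟨f ≫ g, inferInstance⟩

/-- The length function on `ind C`. -/
noncomputable def Ind.length : Ind C → ℕ :=
  Quotient.lift (fun X => GabrielRoiter.length X.1) (by
    rintro X Y ⟨e⟩
    exact length_eq_of_iso e)

/-- The Gabriel–Roiter measure: the chain length function on `ind C` induced by the length. -/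
noncomputable def measure (X : Ind C) : NatChain :=
  chainLength Ind.length X

variable (C) in
/-- The isomorphism classes of simple objects of `C`. -/
def simpleClasses : Set (Quotient (isIsomorphicSetoid C)) :=
  {q | ∃ S : C, Simple S ∧ q = Quotient.mk _ S}

/-- `φ : X ⟶ Y` is left almost split: it is not a split monomorphism, and every map from `X` that
is not a split monomorphism factors through `φ`. -/
def IsLeftAlmostSplit {X Y : C} (φ : X ⟶ Y) : Prop :=
  ¬ IsSplitMono φ ∧
    ∀ ⦃Y' : C⦄ (f : X ⟶ Y'), ¬ IsSplitMono f → ∃ g : Y ⟶ Y', φ ≫ g = f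

end Abelian

end GabrielRoiter

/-!
Write `φ v : v ⟶ Z v` for a left almost split map starting at the indecomposable object `v`. The
sequence `X i` enumerates the values of the Gabriel–Roiter measure `μ` on the *take-off part*: the
set of all `x` in `ind C` for which only finitely many `y` satisfy `μ y ≤ μ x`. This set is closed
under passing to smaller measures, and all fibres and initial segments of `μ` on it are finite, so
the only thing to show is that it is infinite (`infinite_takeOff`).

Everything rests on the main property of the measure (`exists_measure_lt_or_isIso`): if an
indecomposable `X` embeds into a product of indecomposables `Y i`, then `μ X < μ (Y i)` for some
`i`, or some component `X ⟶ Y i` is an isomorphism.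

Suppose that the take-off part `M` is finite. It contains the simple objects. For `x ∉ M`, let
`v ∈ M` be a subobject of `x` of maximal measure. The embedding of `v` factors through `φ v` and a
map `f : Z v ⟶ x`; since `φ v` does not split, the main property gives a direct summand of the image
of `f` with measure larger than `μ v`. It is a subobject of `x`, so by the choice of `v` it is not
in `M`, and its length is at most that of `Z v`. Hence the values of `μ` outside `M` are bounded
below by values of objects of bounded length, of which there are finitely many, and there is a least
value `I = μ w` outside `M` (`exists_minimal_measure_notMem`).

The objects of measure at most `I` lie in `M` or have the same length as `w`, so their lengths are
bounded. By the main property, the objects which embed into products of such indecomposables form a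
class closed under subobjects and finite direct sums, so every object has a largest quotient in
this class, and left almost split maps exist relative to this class. Starting from the finitely many
simple objects and iterating these relative left almost split maps, the Harada–Sai lemma
(`RadicalPath.eq_zero`) shows that every indecomposable of measure at most `I` is met after a bounded
number of steps (`finite_measure_le_of_length_le`). So `w` belongs to the take-off part after all.
-/

namespace GabrielRoiter

/-! ### Lengths of subobjects and quotients -/

section Length

variable {C : Type u} [Category.{v} C] [Abelian C]

/-- `SeriesTo K n`: there is a chain `0 = X₀ ⊆ ⋯ ⊆ Xₙ = K` of subobjects of `X` whose successive
quotients are simple. -/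
inductive SeriesTo {X : C} : Subobject X → ℕ → Prop
  | bot : SeriesTo ⊥ 0
  | step {K L : Subobject X} {n : ℕ} (hK : SeriesTo K n) (h : K ≤ L)
      (hs : Simple (cokernel (Subobject.ofLE K L h))) : SeriesTo L (n + 1)

theorem IsCompositionSeries.seriesTo {X : C} {n : ℕ} {s : Fin (n + 1) → Subobject X}
    (hs : IsCompositionSeries s) (i : Fin (n + 1)) : SeriesTo (s i) i := by
  obtain ⟨h0, -, h⟩ := hs
  induction i using Fin.induction with
  | zero => rw [h0]; exact .bot
  | succ i ih =>
    obtain ⟨hle, hsimple⟩ := h i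
    exact .step ih hle hsimple

theorem SeriesTo.exists_series {X : C} {K : Subobject X} {n : ℕ} (h : SeriesTo K n) :
    ∃ s : Fin (n + 1) → Subobject X, s 0 = ⊥ ∧ s (Fin.last n) = K ∧
      ∀ i : Fin n, ∃ h : s i.castSucc ≤ s i.succ, Simple (cokernel (Subobject.ofLE _ _ h)) := by
  induction h with
  | bot => exact ⟨fun _ => ⊥, rfl, rfl, fun i => i.elim0⟩
  | @step K L n hK hle hs ih =>
    obtain ⟨s, h0, h1, h2⟩ := ih
    subst h1
    refine ⟨Fin.snoc s L, ?_, Fin.snoc_last _ _, fun i => ?_⟩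
    · rw [← h0, ← Fin.castSucc_zero, Fin.snoc_castSucc]
    · induction i using Fin.lastCases with
      | last =>
        rw [Fin.succ_last, Fin.snoc_last, Fin.snoc_castSucc]
        exact ⟨hle, hs⟩
      | cast i =>
        rw [← Fin.castSucc_succ, Fin.snoc_castSucc, Fin.snoc_castSucc]
        exact h2 i

theorem hasCompositionSeries_iff {X : C} {n : ℕ} :
    HasCompositionSeries X n ↔ SeriesTo (⊤ : Subobject X) n := by
  constructor
  · rintro ⟨s, hs⟩
    have := hs.seriesTo (Fin.last n)
    rwa [hs.2.1] at this
  · exact fun h => h.exists_series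

/-- A map into the ambient object of a subobject `L` which is killed by the quotient map
`L ⟶ L / K` factors through `K`. -/
theorem exists_factor_of_comp_cokernel_eq_zero {X T : C} {K L : Subobject X} (h : K ≤ L)
    (x : T ⟶ (L : C)) (hx : x ≫ cokernel.π (Subobject.ofLE K L h) = 0) :
    ∃ y : T ⟶ (K : C), y ≫ Subobject.ofLE K L h = x :=
  ⟨Abelian.monoLift _ x hx, Abelian.monoLift_comp _ x hx⟩

/-- Intersecting a simple step `K ⊆ L` with a subobject `A` gives an equality or a simple step,
and in the second case `A` contains `L` if it contains `K`. -/
theorem pullback_le_or_simple {A X : C} (i : A ⟶ X) [Mono i] {K L : Subobject X} (h : K ≤ L)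
    (hs : Simple (cokernel (Subobject.ofLE K L h))) :
    (Subobject.pullback i).obj L ≤ (Subobject.pullback i).obj K ∨
      ((∃ h' : (Subobject.pullback i).obj K ≤ (Subobject.pullback i).obj L,
        Simple (cokernel (Subobject.ofLE _ _ h'))) ∧
        (K ≤ Subobject.mk i → L ≤ Subobject.mk i)) := by
  have h' : (Subobject.pullback i).obj K ≤ (Subobject.pullback i).obj L :=
    (Subobject.pullback i).monotone h
  have wK := (Subobject.isPullback i K).w
  have wL := (Subobject.isPullback i L).w
  have hfac : Subobject.ofLE _ _ h' ≫ Subobject.pullbackπ i L =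
      Subobject.pullbackπ i K ≫ Subobject.ofLE K L h := by
    rw [← cancel_mono L.arrow]
    simp [wK, wL]
  let q : (((Subobject.pullback i).obj L : Subobject A) : C) ⟶ cokernel (Subobject.ofLE K L h) :=
    Subobject.pullbackπ i L ≫ cokernel.π _
  have lift : ∀ {T : C} (x : T ⟶ (((Subobject.pullback i).obj L : Subobject A) : C)),
      x ≫ q = 0 → ∃ y, y ≫ Subobject.ofLE _ _ h' = x := by
    intro T x hx
    obtain ⟨y, hy⟩ := exists_factor_of_comp_cokernel_eq_zero h (x ≫ Subobject.pullbackπ i L)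
      (by simpa [q] using hx)
    have hcomm : y ≫ K.arrow = (x ≫ ((Subobject.pullback i).obj L).arrow) ≫ i := by
      rw [Category.assoc, ← wL, ← Category.assoc, ← hy]
      simp
    refine ⟨(Subobject.isPullback i K).lift y (x ≫ ((Subobject.pullback i).obj L).arrow) hcomm, ?_⟩
    rw [← cancel_mono ((Subobject.pullback i).obj L).arrow]
    simp
  by_cases hq : q = 0
  · left
    obtain ⟨y, hy⟩ := lift (𝟙 _) (by simp [hq])
    refine Subobject.le_of_comm y ?_
    rw [← Subobject.ofLE_arrow h', ← Category.assoc, hy, Category.id_comp]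
  · right
    have hepi : Epi q := epi_of_nonzero_to_simple hq
    have hzero : Subobject.ofLE _ _ h' ≫ q = 0 := by
      simp only [q, ← Category.assoc, hfac]
      simp
    refine ⟨⟨h', ?_⟩, fun hK => ?_⟩
    · let S := ShortComplex.mk _ q hzero
      have hS : S.Exact := S.exact_of_f_is_kernel
        (KernelFork.IsLimit.ofι' _ _ fun k hk => ⟨(lift k hk).choose, (lift k hk).choose_spec⟩)
      have : Epi S.g := hepi
      have : Simple (CokernelCofork.ofπ S.g S.zero).pt := hs
      exact Simple.of_iso
        ((cokernelIsCokernel _).coconePointUniqueUpToIso hS.gIsCokernel)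
    · let c := cokernel.π i
      obtain ⟨k, hk⟩ : ∃ k, k ≫ i = K.arrow :=
        ⟨Subobject.ofLEMk K i hK, Subobject.ofLEMk_comp hK⟩
      have h0 : Subobject.ofLE K L h ≫ L.arrow ≫ c = 0 := by
        rw [← Category.assoc, Subobject.ofLE_arrow, ← hk, Category.assoc, cokernel.condition,
          comp_zero]
      have hg : cokernel.desc _ (L.arrow ≫ c) h0 = 0 := by
        rw [← cancel_epi q]
        simp only [q, Category.assoc, cokernel.π_desc, comp_zero]
        rw [← Category.assoc, wL, Category.assoc, cokernel.condition, comp_zero]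
      have hLc : L.arrow ≫ c = 0 := by
        rw [← cokernel.π_desc _ _ h0, hg, comp_zero]
      exact Subobject.le_mk_of_comm (Abelian.monoLift i L.arrow hLc)
        (Abelian.monoLift_comp i L.arrow hLc)

/-- A series of `X` induces one of no greater length on a subobject, with equality of the lengths
only if no step collapses. Applied to a shortest series, this replaces the Jordan–Hölder theorem. -/
theorem SeriesTo.pullback {A X : C} (i : A ⟶ X) [Mono i] {K : Subobject X} {n : ℕ}
    (h : SeriesTo K n) :
    ∃ k ≤ n, SeriesTo ((Subobject.pullback i).obj K) k ∧ (k = n → K ≤ Subobject.mk i) := by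
  induction h with
  | bot =>
    refine ⟨0, le_rfl, ?_, fun _ => bot_le⟩
    have : (Subobject.pullback i).obj ⊥ = ⊥ := by
      rw [eq_bot_iff]
      have w := (Subobject.isPullback i (⊥ : Subobject X)).w
      rw [Subobject.bot_arrow, comp_zero] at w
      have h0 : ((Subobject.pullback i).obj (⊥ : Subobject X)).arrow = 0 := by
        rw [← cancel_mono i, ← w, zero_comp]
      refine Subobject.le_of_comm 0 ?_
      rw [h0, zero_comp]
    rw [this]
    exact .bot
  | @step K L n hK hle hs ih =>
    obtain ⟨k, hk, hser, heq⟩ := ih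
    rcases pullback_le_or_simple i hle hs with h1 | ⟨⟨h', hs'⟩, himp⟩
    · refine ⟨k, by omega, ?_, fun h => by omega⟩
      rwa [le_antisymm h1 ((Subobject.pullback i).monotone hle)]
    · exact ⟨k + 1, by omega, .step hser h' hs', fun h => himp (heq (by omega))⟩

theorem IsLengthCategory.seriesTo_top (hC : IsLengthCategory C) (X : C) :
    SeriesTo (⊤ : Subobject X) (length X) :=
  hasCompositionSeries_iff.1 (Nat.sInf_mem (hC X))

theorem length_le_of_seriesTo {X : C} {n : ℕ} (h : SeriesTo (⊤ : Subobject X) n) :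
    length X ≤ n :=
  Nat.sInf_le (hasCompositionSeries_iff.2 h)

theorem length_le_and_isIso_of_mono (hC : IsLengthCategory C) {A X : C} (i : A ⟶ X) [Mono i] :
    length A ≤ length X ∧ (length A = length X → IsIso i) := by
  obtain ⟨k, hk, hser, heq⟩ := (hC.seriesTo_top X).pullback i
  rw [Subobject.pullback_top] at hser
  have hle := length_le_of_seriesTo hser
  refine ⟨hle.trans hk, fun h => ?_⟩
  rw [Subobject.isIso_iff_mk_eq_top]
  exact top_le_iff.1 (heq (by omega))

theorem length_le_of_mono (hC : IsLengthCategory C) {A X : C} (i : A ⟶ X) [Mono i] :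
    length A ≤ length X :=
  (length_le_and_isIso_of_mono hC i).1

theorem isIso_of_mono_of_length_le (hC : IsLengthCategory C) {A X : C} (i : A ⟶ X) [Mono i]
    (h : length X ≤ length A) : IsIso i :=
  (length_le_and_isIso_of_mono hC i).2 (le_antisymm (length_le_of_mono hC i) h)

theorem length_lt_of_mono (hC : IsLengthCategory C) {A X : C} (i : A ⟶ X) [Mono i]
    (h : ¬ IsIso i) : length A < length X := by
  by_contra hlt
  exact h (isIso_of_mono_of_length_le hC i (not_lt.1 hlt))

theorem length_lt_of_lt (hC : IsLengthCategory C) {X : C} {K L : Subobject X} (h : K < L) :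
    length (K : C) < length (L : C) := by
  refine length_lt_of_mono hC (Subobject.ofLE K L h.le) fun hiso => h.not_ge ?_
  exact Subobject.le_of_comm (inv (Subobject.ofLE K L h.le)) (by simp)

/-- The preimages of a composition series under an epimorphism form a strict chain above the
kernel. -/
theorem SeriesTo.add_length_le (hC : IsLengthCategory C) {A B : C} (p : A ⟶ B) [Epi p]
    {K : Subobject B} {n : ℕ} (h : SeriesTo K n) :
    n + length (((Subobject.pullback p).obj ⊥ : Subobject A) : C) ≤
      length (((Subobject.pullback p).obj K : Subobject A) : C) := by
  induction h with
  | bot => simp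
  | @step K L n hK hle hs ih =>
    have hlt : (Subobject.pullback p).obj K < (Subobject.pullback p).obj L := by
      refine lt_of_le_not_ge ((Subobject.pullback p).monotone hle) fun hge => ?_
      have wK := (Subobject.isPullback p K).w
      have wL := (Subobject.isPullback p L)
      have hepi : Epi (Subobject.pullbackπ p L) :=
        MorphismProperty.of_isPullback (P := .epimorphisms C) wL.flip ‹Epi p›
      have hz : cokernel.π (Subobject.ofLE K L hle) = 0 := by
        rw [← cancel_epi (Subobject.pullbackπ p L), comp_zero]
        have : Subobject.pullbackπ p L =
            (Subobject.ofLE _ _ hge ≫ Subobject.pullbackπ p K) ≫ Subobject.ofLE K L hle := by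
          rw [← cancel_mono L.arrow]
          simp [wL.w, wK]
        rw [this, Category.assoc, cokernel.condition, comp_zero]
      exact id_nonzero (cokernel (Subobject.ofLE K L hle))
        ((cancel_epi (cokernel.π _)).1 (by rw [hz, zero_comp, zero_comp]))
    have := length_lt_of_lt hC hlt
    omega

theorem length_le_and_isIso_of_epi (hC : IsLengthCategory C) {A B : C} (p : A ⟶ B) [Epi p] :
    length B ≤ length A ∧ (length B = length A → IsIso p) := by
  have h := (hC.seriesTo_top B).add_length_le hC p
  rw [Subobject.pullback_top] at h
  have htop : length ((⊤ : Subobject A) : C) ≤ length A :=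
    length_le_of_mono hC (⊤ : Subobject A).arrow
  refine ⟨by omega, fun heq => ?_⟩
  -- a nonzero kernel would have positive length
  have hk : length (((Subobject.pullback p).obj ⊥ : Subobject A) : C) = 0 := by omega
  have hbot : (Subobject.pullback p).obj ⊥ = ⊥ := by
    by_contra hne
    have := length_lt_of_lt hC (bot_lt_iff_ne_bot.2 hne)
    omega
  have hp : Mono p := by
    refine Preadditive.mono_of_cancel_zero _ fun {T} t ht => ?_
    let l := (Subobject.isPullback p (⊥ : Subobject B)).lift 0 t (by simp [ht])
    have hl : l ≫ ((Subobject.pullback p).obj ⊥).arrow = t :=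
      (Subobject.isPullback p (⊥ : Subobject B)).lift_snd _ _ _
    have h0 : ((Subobject.pullback p).obj (⊥ : Subobject B)).arrow = 0 := by
      have key : ∀ K : Subobject A, K = ⊥ → K.arrow = 0 := by
        rintro _ rfl
        exact Subobject.bot_arrow
      exact key _ hbot
    rw [← hl, h0, comp_zero]
  exact isIso_of_mono_of_epi p

theorem length_le_of_epi (hC : IsLengthCategory C) {A B : C} (p : A ⟶ B) [Epi p] :
    length B ≤ length A :=
  (length_le_and_isIso_of_epi hC p).1

theorem isIso_of_epi_of_length_le (hC : IsLengthCategory C) {A B : C} (p : A ⟶ B) [Epi p]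
    (h : length A ≤ length B) : IsIso p :=
  (length_le_and_isIso_of_epi hC p).2 (le_antisymm (length_le_of_epi hC p) h)

theorem length_lt_of_epi (hC : IsLengthCategory C) {A B : C} (p : A ⟶ B) [Epi p]
    (h : ¬ IsIso p) : length B < length A := by
  by_contra hlt
  exact h (isIso_of_epi_of_length_le hC p (not_lt.1 hlt))

theorem length_image_le (hC : IsLengthCategory C) {A B : C} (f : A ⟶ B) :
    length (image f) ≤ length A :=
  length_le_of_epi hC (factorThruImage f)

open ZeroObject in
theorem isZero_of_length_eq_zero (hC : IsLengthCategory C) {A : C} (h : length A = 0) :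
    IsZero A := by
  have hm : Mono (0 : (0 : C) ⟶ A) := ⟨fun _ _ _ => Subsingleton.elim _ _⟩
  have := isIso_of_mono_of_length_le hC (0 : (0 : C) ⟶ A) (by omega)
  exact (isZero_zero C).of_iso (asIso (0 : (0 : C) ⟶ A)).symm

theorem length_eq_one_of_simple (hC : IsLengthCategory C) (S : C) [hS : Simple S] :
    length S = 1 := by
  have h1 : length S ≤ 1 := by
    refine length_le_of_seriesTo (.step .bot bot_le ?_)
    have hz : Subobject.ofLE (⊥ : Subobject S) ⊤ bot_le = 0 := by
      rw [← cancel_mono (⊤ : Subobject S).arrow]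
      simp
    have e : cokernel (Subobject.ofLE (⊥ : Subobject S) ⊤ bot_le) ≅ S :=
      cokernelIsoOfEq hz ≪≫ cokernelZeroIsoTarget ≪≫ asIso (⊤ : Subobject S).arrow
    exact Simple.of_iso e
  have h0 : length S ≠ 0 := fun h => Simple.not_isZero S (isZero_of_length_eq_zero hC h)
  omega

end Length

/-! ### Decompositions into indecomposable objects and the Harada–Sai lemma -/

section Decomposition

variable {C : Type u} [Category.{v} C] [Abelian C]

theorem isIso_of_isSplitMono {A B : C} (f : A ⟶ B) [IsSplitMono f] (hA : ¬ IsZero A)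
    (hB : Indecomposable B) : IsIso f := by
  let e : B ≅ A ⊞ cokernel f :=
    biprod.uniqueUpToIso _ _
      (isBilimitBinaryBiconeOfIsSplitMonoOfCokernel (cokernelIsCokernel f))
  rcases hB.2 _ _ e with h | h
  · exact absurd h hA
  · have : Epi f := Preadditive.epi_of_isZero_cokernel f h
    exact isIso_of_mono_of_epi f

/-- A decomposition of `Y` as a finite direct sum of indecomposable objects, given by the
inclusions and the projections of the summands. -/
structure IndecDecomposition (Y : C) where
  /-- the index set of the summands -/
  index : Type
  [fintype : Fintype index]
  /-- the summands -/
  obj : index → C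
  /-- the inclusions -/
  ι : ∀ j, obj j ⟶ Y
  /-- the projections -/
  π : ∀ j, Y ⟶ obj j
  indecomposable : ∀ j, Indecomposable (obj j)
  ι_π : ∀ j, ι j ≫ π j = 𝟙 (obj j)
  total : ∑ j, π j ≫ ι j = 𝟙 Y

attribute [instance] IndecDecomposition.fintype

namespace IndecDecomposition

variable {Y : C} (D : IndecDecomposition Y)

theorem mono_ι (j : D.index) : Mono (D.ι j) :=
  (SplitMono.mk (D.π j) (D.ι_π j)).mono

theorem epi_π (j : D.index) : Epi (D.π j) :=
  (SplitEpi.mk (D.ι j) (D.ι_π j)).epi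

theorem eq_sum {X : C} (f : Y ⟶ X) : f = ∑ j, D.π j ≫ D.ι j ≫ f := by
  conv_lhs => rw [← Category.id_comp f, ← D.total, Preadditive.sum_comp]
  simp only [Category.assoc]

theorem eq_zero {T : C} (t : T ⟶ Y) (h : ∀ j, t ≫ D.π j = 0) : t = 0 := by
  rw [← Category.comp_id t, ← D.total, Preadditive.comp_sum]
  refine Finset.sum_eq_zero fun j _ => ?_
  rw [← Category.assoc, h, zero_comp]

/-- The decomposition of a direct sum. -/
noncomputable def sum {A B : C} (e : Y ≅ A ⊞ B) (D : IndecDecomposition A) (E : IndecDecomposition B) :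
    IndecDecomposition Y where
  index := D.index ⊕ E.index
  obj := Sum.elim D.obj E.obj
  ι := fun j => match j with
    | .inl j => D.ι j ≫ biprod.inl ≫ e.inv
    | .inr j => E.ι j ≫ biprod.inr ≫ e.inv
  π := fun j => match j with
    | .inl j => e.hom ≫ biprod.fst ≫ D.π j
    | .inr j => e.hom ≫ biprod.snd ≫ E.π j
  indecomposable := by
    rintro (j | j)
    · exact D.indecomposable j
    · exact E.indecomposable j
  ι_π := by
    rintro (j | j)
    · simp [D.ι_π]
    · simp [E.ι_π]
  total := by
    have hD : ∑ j, (e.hom ≫ biprod.fst ≫ D.π j) ≫ (D.ι j ≫ biprod.inl ≫ e.inv) =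
        (e.hom ≫ biprod.fst) ≫ (∑ j, D.π j ≫ D.ι j) ≫ (biprod.inl ≫ e.inv) := by
      simp only [Preadditive.comp_sum, Preadditive.sum_comp, Category.assoc]
    have hE : ∑ j, (e.hom ≫ biprod.snd ≫ E.π j) ≫ (E.ι j ≫ biprod.inr ≫ e.inv) =
        (e.hom ≫ biprod.snd) ≫ (∑ j, E.π j ≫ E.ι j) ≫ (biprod.inr ≫ e.inv) := by
      simp only [Preadditive.comp_sum, Preadditive.sum_comp, Category.assoc]
    rw [D.total] at hD
    rw [E.total] at hE
    refine (Fintype.sum_sum_type _).trans ((congrArg₂ (· + ·) hD hE).trans ?_)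
    calc _ = e.hom ≫ (biprod.fst ≫ biprod.inl + biprod.snd ≫ biprod.inr) ≫ e.inv := by
          rw [Preadditive.add_comp, Preadditive.comp_add]
          simp only [Category.assoc, Category.id_comp]
      _ = 𝟙 Y := by rw [biprod.total, Category.id_comp, e.hom_inv_id]

end IndecDecomposition

theorem not_isIso_inl {A B : C} (hB : ¬ IsZero B) : ¬ IsIso (biprod.inl : A ⟶ A ⊞ B) :=
  fun h => hB ((Biprod.isIso_inl_iff_isZero A B).1 h)

theorem not_isIso_inr {A B : C} (hA : ¬ IsZero A) : ¬ IsIso (biprod.inr : B ⟶ A ⊞ B) := by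
  intro h
  have h0 : (biprod.fst : A ⊞ B ⟶ A) = 0 := by
    rw [← cancel_epi (biprod.inr : B ⟶ A ⊞ B), biprod.inr_fst, comp_zero]
  apply hA
  rw [IsZero.iff_id_eq_zero, ← biprod.inl_fst (X := A) (Y := B), h0, comp_zero]

theorem nonempty_indecDecomposition (hC : IsLengthCategory C) (Y : C) :
    Nonempty (IndecDecomposition Y) := by
  induction hn : length Y using Nat.strong_induction_on generalizing Y with
  | _ n ih =>
    subst hn
    by_cases h0 : IsZero Y
    · exact ⟨{ index := Empty, obj := Empty.elim, ι := fun j => j.elim, π := fun j => j.elim,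
               indecomposable := fun j => j.elim, ι_π := fun j => j.elim,
               total := h0.eq_of_src _ _ }⟩
    by_cases hY : Indecomposable Y
    · exact ⟨{ index := Unit, obj := fun _ => Y, ι := fun _ => 𝟙 Y, π := fun _ => 𝟙 Y,
               indecomposable := fun _ => hY, ι_π := fun _ => by simp, total := by simp }⟩
    · obtain ⟨A, B, e, hA, hB⟩ : ∃ (A B : C) (_ : Y ≅ A ⊞ B), ¬ IsZero A ∧ ¬ IsZero B := by
        by_contra! hcon
        exact hY ⟨h0, fun A B e => or_iff_not_imp_left.2 (hcon A B e)⟩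
      rw [length_eq_of_iso e] at ih
      obtain ⟨D⟩ := ih _ (length_lt_of_mono hC (biprod.inl : A ⟶ A ⊞ B) (not_isIso_inl hB)) A rfl
      obtain ⟨E⟩ := ih _ (length_lt_of_mono hC (biprod.inr : B ⟶ A ⊞ B) (not_isIso_inr hA)) B rfl
      exact ⟨D.sum e E⟩

/-- A chosen decomposition into indecomposable objects. -/
noncomputable def decomposition (hC : IsLengthCategory C) (Y : C) : IndecDecomposition Y :=
  (nonempty_indecDecomposition hC Y).some

theorem exists_mono_of_simple (hC : IsLengthCategory C) {X : C} (hX : ¬ IsZero X) :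
    ∃ (S : C) (f : S ⟶ X), Simple S ∧ Mono f := by
  induction hn : length X using Nat.strong_induction_on generalizing X with
  | _ n ih =>
    subst hn
    by_cases hS : Simple X
    · exact ⟨X, 𝟙 X, hS, inferInstance⟩
    · obtain ⟨Y, f, hf, hne, hiso⟩ : ∃ (Y : C) (f : Y ⟶ X), Mono f ∧ f ≠ 0 ∧ ¬ IsIso f := by
        by_contra! hcon
        refine hS ⟨fun {Y} f hf => ⟨fun hiso h0 => hX ?_, hcon Y f hf⟩⟩
        rw [IsZero.iff_id_eq_zero, ← cancel_epi f, h0, zero_comp, zero_comp]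
      have hY : ¬ IsZero Y := fun h => hne (h.eq_of_src _ _)
      obtain ⟨S, g, hS, hg⟩ := ih _ (length_lt_of_mono hC f hiso) hY rfl
      exact ⟨S, g ≫ f, hS, inferInstance⟩

end Decomposition

section HaradaSai

variable {C : Type u} [Category.{v} C] [Abelian C]

/-- `RadicalPath b n f`: the map `f` is a composite of `n` non-isomorphisms between
indecomposable objects of length at most `b`. -/
inductive RadicalPath (b : ℕ) : ℕ → ∀ {A B : C}, (A ⟶ B) → Prop
  | nil {A : C} (hA : Indecomposable A) (hb : length A ≤ b) : RadicalPath b 0 (𝟙 A)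
  | snoc {n : ℕ} {A B B' : C} {f : A ⟶ B} (hf : RadicalPath b n f) (g : B ⟶ B')
      (hB' : Indecomposable B') (hb : length B' ≤ b) (hg : ¬ IsIso g) :
      RadicalPath b (n + 1) (f ≫ g)

namespace RadicalPath

variable {b : ℕ}

theorem source {n : ℕ} {A B : C} {f : A ⟶ B} (h : RadicalPath b n f) :
    Indecomposable A ∧ length A ≤ b := by
  induction h with
  | nil hA hb => exact ⟨hA, hb⟩
  | snoc _ _ _ _ _ ih => exact ih

theorem target {n : ℕ} {A B : C} {f : A ⟶ B} (h : RadicalPath b n f) :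
    Indecomposable B ∧ length B ≤ b := by
  cases h with
  | nil hA hb => exact ⟨hA, hb⟩
  | snoc _ _ hB hb _ => exact ⟨hB, hb⟩

theorem exists_split {n m : ℕ} {A B : C} {f : A ⟶ B} (h : RadicalPath b (n + m) f) :
    ∃ (E : C) (f₁ : A ⟶ E) (f₂ : E ⟶ B), RadicalPath b n f₁ ∧ RadicalPath b m f₂ ∧
      f = f₁ ≫ f₂ := by
  induction m generalizing B with
  | zero => exact ⟨B, f, 𝟙 B, h, .nil h.target.1 h.target.2, by simp⟩
  | succ m ih =>
    rw [← add_assoc] at h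
    cases h with
    | snoc hf g hB' hb hg =>
      obtain ⟨E, f₁, f₂, h₁, h₂, rfl⟩ := ih hf
      exact ⟨E, f₁, f₂ ≫ g, h₁, .snoc h₂ g hB' hb hg, by simp⟩

end RadicalPath

theorem length_image_comp_le_left (hC : IsLengthCategory C) {A B D : C} (f : A ⟶ B)
    (g : B ⟶ D) : length (image (f ≫ g)) ≤ length (image f) := by
  let q : image f ⟶ D := image.ι f ≫ g
  have h : factorThruImage f ≫ q = f ≫ g := by simp [q]
  have hm : length (image (f ≫ g)) ≤ length (image q) := by
    let l : image (f ≫ g) ⟶ image q := image.lift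
      { I := image q, m := image.ι q, e := factorThruImage f ≫ factorThruImage q,
        fac := by rw [Category.assoc, image.fac, h] }
    have : Mono l := mono_of_mono_fac (image.lift_fac _)
    exact length_le_of_mono hC l
  exact hm.trans (length_image_le hC q)

theorem length_image_comp_le_right (hC : IsLengthCategory C) {A B D : C} (f : A ⟶ B)
    (g : B ⟶ D) : length (image (f ≫ g)) ≤ length (image g) := by
  let l : image (f ≫ g) ⟶ image g := image.lift
    { I := image g, m := image.ι g, e := f ≫ factorThruImage g }
  have : Mono l := mono_of_mono_fac (image.lift_fac _)
  exact length_le_of_mono hC l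

/-- If the passage from `f` to `f ≫ g` and from `g` to `f ≫ g` does not shrink the image, the image
of `f` is a complement of the kernel of `g`. For indecomposable `B` this forces `f` to be an
epimorphism and `g` to be a monomorphism. -/
theorem epi_and_mono_of_length_image_le (hC : IsLengthCategory C) {A B D : C} (f : A ⟶ B)
    (g : B ⟶ D) (hB : Indecomposable B) (h0 : f ≫ g ≠ 0)
    (hf : length (image f) ≤ length (image (f ≫ g)))
    (hg : length (image g) ≤ length (image (f ≫ g))) : Epi f ∧ Mono g := by
  let r : image f ⟶ image g := image.ι f ≫ factorThruImage g
  have hfr : (factorThruImage f ≫ r) ≫ image.ι g = f ≫ g := by simp [r]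
  let l : image (f ≫ g) ⟶ image r := image.lift
    { I := image r, m := image.ι r ≫ image.ι g, e := factorThruImage f ≫ factorThruImage r,
      fac := by rw [← hfr]; simp }
  have hl : Mono l := mono_of_mono_fac (image.lift_fac _)
  have hlr := length_le_of_mono hC l
  have h1 : IsIso (image.ι r) := isIso_of_mono_of_length_le hC _ (hg.trans hlr)
  have h2 : IsIso (factorThruImage r) := isIso_of_epi_of_length_le hC _ (hf.trans hlr)
  have hr : IsIso r := by
    rw [← image.fac r]
    infer_instance
  have hsplit : IsSplitMono (image.ι f) :=
    ⟨⟨⟨factorThruImage g ≫ inv r, by rw [← Category.assoc]; exact IsIso.hom_inv_id r⟩⟩⟩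
  have hne : ¬ IsZero (image f) := fun hz => h0 (by
    rw [← image.fac f, hz.eq_of_tgt (factorThruImage f) 0]; simp)
  have hi : IsIso (image.ι f) := isIso_of_isSplitMono _ hne hB
  constructor
  · rw [← image.fac f]
    infer_instance
  · have hiso : IsIso (factorThruImage g) := by
      have : factorThruImage g = inv (image.ι f) ≫ r := by simp [r]
      rw [this]
      infer_instance
    rw [← image.fac g]
    infer_instance

/-- The Harada–Sai lemma, with the estimate for the length of the image on which the induction
runs. -/
theorem RadicalPath.length_image_add_le (hC : IsLengthCategory C) {b : ℕ} (k : ℕ) {A B : C}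
    {f : A ⟶ B} (h : RadicalPath b (2 ^ k - 1) f) : f = 0 ∨ length (image f) + k ≤ b := by
  induction k generalizing A B with
  | zero => exact .inr ((length_image_le hC f).trans h.source.2)
  | succ k ih =>
    have hpow : 2 ^ (k + 1) - 1 = (2 ^ k - 1 + 1) + (2 ^ k - 1) := by
      have := Nat.one_le_two_pow (n := k)
      omega
    rw [hpow] at h
    obtain ⟨E, f₁, f₂, h₁, h₂, rfl⟩ := h.exists_split
    cases h₁ with
    | @snoc _ _ E' _ e hf g hB' hb hg =>
      refine or_iff_not_imp_left.2 fun hne => ?_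
      have hne' : e ≫ g ≫ f₂ ≠ 0 := by rwa [← Category.assoc]
      have he : e ≠ 0 := by rintro rfl; simp at hne
      have hf₂ : f₂ ≠ 0 := by rintro rfl; simp at hne
      have hE' := hf.target.1
      have b1 := (ih hf).resolve_left he
      have b2 := (ih h₂).resolve_left hf₂
      by_contra hlt
      have c1 := length_image_comp_le_left hC (e ≫ g) f₂
      have c2 := length_image_comp_le_left hC e g
      have c3 := length_image_comp_le_right hC (e ≫ g) f₂
      have c4 := length_image_comp_le_right hC e (g ≫ f₂)
      have c5 := length_image_comp_le_right hC g f₂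
      rw [← Category.assoc] at c4
      have m1 := (epi_and_mono_of_length_image_le hC e (g ≫ f₂) hE' hne'
        (by rw [← Category.assoc]; omega) (by rw [← Category.assoc]; omega)).2
      have m2 := (epi_and_mono_of_length_image_le hC (e ≫ g) f₂ hB' hne
        (by omega) (by omega)).1
      have hgm : Mono g := mono_of_mono g f₂
      have hge : Epi g := epi_of_epi e g
      exact hg (isIso_of_mono_of_epi g)

theorem RadicalPath.eq_zero (hC : IsLengthCategory C) {b : ℕ} {A B : C} {f : A ⟶ B}
    (h : RadicalPath b (2 ^ b - 1) f) : f = 0 := by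
  rcases h.length_image_add_le hC b with h0 | hle
  · exact h0
  · have hz := isZero_of_length_eq_zero hC (show length (image f) = 0 by omega)
    rw [← image.fac f, hz.eq_of_tgt (factorThruImage f) 0, zero_comp]

end HaradaSai

/-! ### The Gabriel–Roiter measure of subobjects -/

namespace NatChain

theorem lt_iff {X Y : NatChain} :
    X < Y ↔ ∃ b ∈ Y.toFinset, b ∉ X.toFinset ∧ ∀ a ∈ X.toFinset, a ∉ Y.toFinset → b < a := by
  rw [← not_le, le_iff]
  push Not
  constructor
  · rintro ⟨b, hb, hb', h⟩
    exact ⟨b, hb, hb', h⟩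
  · rintro ⟨b, hb, hb', h⟩
    exact ⟨b, hb, hb', h⟩

/-- The set `X ∪ {n}`. -/
def insert (n : ℕ) (X : NatChain) : NatChain :=
  ⟨Insert.insert n X.toFinset⟩

theorem mem_insert {n m : ℕ} {X : NatChain} :
    m ∈ (insert n X).toFinset ↔ m = n ∨ m ∈ X.toFinset :=
  Finset.mem_insert

theorem le_of_subset {X Y : NatChain} (h : X.toFinset ⊆ Y.toFinset) : X ≤ Y :=
  le_iff.2 fun _ ha ha' => absurd (h ha) ha'

theorem lt_insert {n : ℕ} {X : NatChain} (h : n ∉ X.toFinset) : X < insert n X :=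
  lt_iff.2 ⟨n, mem_insert.2 (.inl rfl), h, fun _ ha ha' => absurd (mem_insert.2 (.inr ha)) ha'⟩

/-- The comparison of `X` with `Y` is decided at an element of `Y`. -/
theorem insert_lt_of_lt {n : ℕ} {X Y : NatChain} (h : X < Y) (hY : ∀ a ∈ Y.toFinset, a < n) :
    insert n X < Y := by
  obtain ⟨b, hb, hb', h⟩ := lt_iff.1 h
  have hbn := hY b hb
  refine lt_iff.2 ⟨b, hb, ?_, fun a ha ha' => ?_⟩
  · rw [mem_insert]
    rintro (rfl | hx)
    · omega
    · exact hb' hx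
  · rcases mem_insert.1 ha with rfl | hx
    · exact hbn
    · exact h a hx ha'

theorem insert_le_insert {n : ℕ} {X Y : NatChain} (h : X ≤ Y) (hY : ∀ a ∈ Y.toFinset, a < n) :
    insert n X ≤ insert n Y := by
  rcases h.eq_or_lt with rfl | h
  · exact le_rfl
  · exact (insert_lt_of_lt h hY).le.trans (le_of_subset (Finset.subset_insert _ _))

theorem finite_of_bounded (N : ℕ) : {X : NatChain | ∀ a ∈ X.toFinset, a ≤ N}.Finite := by
  refine Set.Finite.subset (((Finset.range (N + 1)).powerset.finite_toSet).image NatChain.mk) ?_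
  rintro ⟨X⟩ hX
  refine ⟨X, ?_, rfl⟩
  rw [Finset.mem_coe, Finset.mem_powerset]
  intro a ha
  have := hX a ha
  rw [Finset.mem_range]
  omega

end NatChain

section Measure

variable {C : Type u} [Category.{v} C] [Abelian C]

theorem Ind.exists_mk (x : Ind C) : ∃ (X : C) (hX : Indecomposable X), x = Ind.mk X hX := by
  obtain ⟨⟨X, hX⟩, rfl⟩ := Quotient.exists_rep x
  exact ⟨X, hX, rfl⟩

theorem Ind.mk_eq_mk {X Y : C} {hX : Indecomposable X} {hY : Indecomposable Y} :
    Ind.mk X hX = Ind.mk Y hY ↔ Nonempty (X ≅ Y) :=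
  Quotient.eq

theorem Ind.mk_le_mk {X Y : C} {hX : Indecomposable X} {hY : Indecomposable Y} :
    Ind.mk X hX ≤ Ind.mk Y hY ↔ ∃ f : X ⟶ Y, Mono f :=
  Iff.rfl

theorem Ind.length_mono (hC : IsLengthCategory C) {x y : Ind C} (h : x ≤ y) :
    x.length ≤ y.length := by
  obtain ⟨X, hX, rfl⟩ := x.exists_mk
  obtain ⟨Y, hY, rfl⟩ := y.exists_mk
  obtain ⟨f, hf⟩ := Ind.mk_le_mk.1 h
  exact length_le_of_mono hC f

theorem Ind.eq_of_le_of_length_le (hC : IsLengthCategory C) {x y : Ind C} (h : x ≤ y)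
    (hl : y.length ≤ x.length) : x = y := by
  obtain ⟨X, hX, rfl⟩ := x.exists_mk
  obtain ⟨Y, hY, rfl⟩ := y.exists_mk
  obtain ⟨f, hf⟩ := Ind.mk_le_mk.1 h
  have := isIso_of_mono_of_length_le hC f hl
  exact Ind.mk_eq_mk.2 ⟨asIso f⟩

theorem Ind.length_strictMono (hC : IsLengthCategory C) {x y : Ind C} (h : x < y) :
    x.length < y.length := by
  by_contra hl
  exact h.ne (Ind.eq_of_le_of_length_le hC h.le (not_lt.1 hl))

theorem mem_le_of_mem_chainValues (hC : IsLengthCategory C) {x : Ind C} {c : NatChain}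
    (hc : c ∈ chainValues Ind.length x) {a : ℕ} (ha : a ∈ c.toFinset) : a ≤ x.length := by
  obtain ⟨X, hX, rfl⟩ := hc
  obtain ⟨y, hy, rfl⟩ := Finset.mem_image.1 ha
  exact Ind.length_mono hC (hX.2.2 hy)

theorem length_mem_of_mem_chainValues {x : Ind C} {c : NatChain}
    (hc : c ∈ chainValues Ind.length x) : x.length ∈ c.toFinset := by
  obtain ⟨X, hX, rfl⟩ := hc
  exact Finset.mem_image_of_mem _ hX.2.1

theorem singleton_mem_chainValues (x : Ind C) :
    (⟨{x.length}⟩ : NatChain) ∈ chainValues Ind.length x :=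
  ⟨{x}, ⟨by simp [IsChain], by simp⟩, by simp⟩

theorem isGreatest_measure (hC : IsLengthCategory C) (x : Ind C) :
    IsGreatest (chainValues Ind.length x) (measure x) := by
  have hfin : (chainValues Ind.length x).Finite :=
    (NatChain.finite_of_bounded x.length).subset
      fun c hc a ha => mem_le_of_mem_chainValues hC hc ha
  obtain ⟨m, hm⟩ := hfin.exists_maximal ⟨_, singleton_mem_chainValues x⟩
  have hex : ∃ c, IsGreatest (chainValues Ind.length x) c :=
    ⟨m, hm.1, fun c hc => (le_total c m).elim id fun h => hm.2 hc h⟩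
  unfold measure chainLength
  rw [dif_pos hex]
  exact hex.choose_spec

theorem mem_measure_le (hC : IsLengthCategory C) {x : Ind C} {a : ℕ}
    (ha : a ∈ (measure x).toFinset) : a ≤ x.length :=
  mem_le_of_mem_chainValues hC (isGreatest_measure hC x).1 ha

theorem length_mem_measure (hC : IsLengthCategory C) (x : Ind C) :
    x.length ∈ (measure x).toFinset :=
  length_mem_of_mem_chainValues (isGreatest_measure hC x).1

theorem length_eq_of_measure_eq (hC : IsLengthCategory C) {x y : Ind C}
    (h : measure x = measure y) : x.length = y.length :=
  le_antisymm (mem_measure_le hC (h ▸ length_mem_measure hC x))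
    (mem_measure_le hC (h ▸ length_mem_measure hC y))

theorem insert_mem_chainValues {x y : Ind C} (h : x < y) {c : NatChain}
    (hc : c ∈ chainValues Ind.length x) :
    NatChain.insert y.length c ∈ chainValues Ind.length y := by
  classical
  obtain ⟨X, ⟨hX, hxX, hmax⟩, rfl⟩ := hc
  refine ⟨Insert.insert y X, ⟨?_, ?_, ?_⟩, ?_⟩
  · rw [Finset.coe_insert]
    exact hX.insert fun z hz _ => .inr ((hmax hz).trans h.le)
  · simp
  · intro z hz
    rcases Finset.mem_insert.1 (Finset.mem_coe.1 hz) with rfl | hz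
    · exact le_rfl
    · exact (hmax hz).trans h.le
  · apply NatChain.ext
    simp [NatChain.insert, Finset.image_insert]

theorem insert_measure_le (hC : IsLengthCategory C) {x y : Ind C} (h : x < y) :
    NatChain.insert y.length (measure x) ≤ measure y :=
  (isGreatest_measure hC y).2 (insert_mem_chainValues h (isGreatest_measure hC x).1)

theorem measure_strictMono (hC : IsLengthCategory C) {x y : Ind C} (h : x < y) :
    measure x < measure y :=
  (NatChain.lt_insert fun hm =>
    (Ind.length_strictMono hC h).not_ge (mem_measure_le hC hm)).trans_le (insert_measure_le hC h)

theorem measure_mono (hC : IsLengthCategory C) {x y : Ind C} (h : x ≤ y) :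
    measure x ≤ measure y := by
  by_cases hyx : y ≤ x
  · rw [Ind.eq_of_le_of_length_le hC h (Ind.length_mono hC hyx)]
  · exact (measure_strictMono hC (lt_of_le_not_ge h hyx)).le

/-- The recursive description of the Gabriel–Roiter measure: a chain of maximal value is obtained
by adding the object to a chain of maximal value for a proper subobject. -/
theorem measure_eq_singleton_or_insert (hC : IsLengthCategory C) (x : Ind C) :
    measure x = ⟨{x.length}⟩ ∨
      ∃ y < x, measure x = NatChain.insert x.length (measure y) := by
  classical
  obtain ⟨X, ⟨hX, hxX, hmax⟩, hval⟩ := (isGreatest_measure hC x).1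
  have hins : Insert.insert x (X.erase x) = X := Finset.insert_erase hxX
  rcases (X.erase x).eq_empty_or_nonempty with he | hne
  · left
    rw [hval, ← hins, he]
    simp
  · right
    obtain ⟨y, hy, hymax⟩ := (X.erase x).exists_max_image Ind.length hne
    have hyX := Finset.mem_of_mem_erase hy
    have hyx : y < x := by
      refine lt_of_le_not_ge (hmax hyX) fun hxy => Finset.ne_of_mem_erase hy ?_
      exact Ind.eq_of_le_of_length_le hC (hmax hyX) (Ind.length_mono hC hxy)
    refine ⟨y, hyx, le_antisymm ?_ (insert_measure_le hC hyx)⟩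
    have hc : (⟨(X.erase x).image Ind.length⟩ : NatChain) ∈ chainValues Ind.length y := by
      refine ⟨X.erase x, ⟨hX.mono (by simp), hy, fun z hz => ?_⟩, rfl⟩
      rcases hX.total (Finset.mem_of_mem_erase hz) hyX with h | h
      · exact h
      · exact (Ind.eq_of_le_of_length_le hC h (hymax z hz)).ge
    have hval' : measure x = NatChain.insert x.length ⟨(X.erase x).image Ind.length⟩ := by
      apply NatChain.ext
      rw [hval]
      simp only [NatChain.insert]
      rw [← Finset.image_insert, hins]
    rw [hval']
    refine NatChain.insert_le_insert ((isGreatest_measure hC y).2 hc) fun a ha => ?_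
    exact (mem_measure_le hC ha).trans_lt (Ind.length_strictMono hC hyx)

end Measure

/-! ### The main property and relative left almost split maps -/

section MainProperty

variable {C : Type u} [Category.{v} C] [Abelian C]

/-- The main property of the Gabriel–Roiter measure: if an indecomposable object `X` embeds into a
product of indecomposable objects `Y i`, then its measure is smaller than that of some `Y i`,
unless a component of the embedding is an isomorphism. -/
theorem exists_measure_lt_or_isIso (hC : IsLengthCategory C) {X : C} (hX : Indecomposable X)
    {ι : Type} {Y : ι → C} (hY : ∀ i, Indecomposable (Y i)) (u : ∀ i, X ⟶ Y i)
    (hu : ∀ {T : C} (t : T ⟶ X), (∀ i, t ≫ u i = 0) → t = 0) :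
    ∃ i, measure (Ind.mk X hX) < measure (Ind.mk (Y i) (hY i)) ∨ IsIso (u i) := by
  induction hn : length X using Nat.strong_induction_on generalizing X ι with
  | _ n ih =>
    subst hn
    let D := fun i => decomposition hC (image (u i))
    -- the `W k` are the indecomposable summands of the images of the `u i`, so that all components
    -- of the embedding of `X` into the product of the `W k` are epimorphisms
    let W : (Σ i, (D i).index) → C := fun k => (D k.1).obj k.2
    have hW : ∀ k, Indecomposable (W k) := fun k => (D k.1).indecomposable k.2
    let w : ∀ k, X ⟶ W k := fun k => factorThruImage (u k.1) ≫ (D k.1).π k.2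
    have hwepi : ∀ k, Epi (w k) := fun k => by
      have := (D k.1).epi_π k.2
      exact epi_comp _ _
    have hw : ∀ {T : C} (t : T ⟶ X), (∀ k, t ≫ w k = 0) → t = 0 := by
      refine fun t ht => hu t fun i => ?_
      have h0 : t ≫ factorThruImage (u i) = 0 :=
        (D i).eq_zero _ fun j => by rw [Category.assoc]; exact ht ⟨i, j⟩
      rw [← image.fac (u i), ← Category.assoc, h0, zero_comp]
    have key : ∃ k, measure (Ind.mk X hX) < measure (Ind.mk (W k) (hW k)) ∨ IsIso (w k) := by
      by_cases hiso : ∃ k, IsIso (w k)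
      · exact hiso.imp fun _ => .inr
      have hlt : ∀ k, length (W k) < length X := fun k =>
        length_lt_of_epi hC (w k) fun h => hiso ⟨k, h⟩
      -- compare `W k` with a proper subobject of `X` from which the measure of `X` is obtained by
      -- adding `length X`, a number exceeding all elements of the measure of `W k`
      rcases measure_eq_singleton_or_insert hC (Ind.mk X hX) with hμ | ⟨y, hy, hμ⟩
      · obtain ⟨k⟩ : Nonempty (Σ i, (D i).index) := by
          by_contra hempty
          refine hX.1 ((IsZero.iff_id_eq_zero X).2 (hw _ fun k => ?_))
          exact absurd ⟨k⟩ hempty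
        refine ⟨k, .inl ?_⟩
        rw [hμ, NatChain.lt_iff]
        refine ⟨_, length_mem_measure hC _, ?_, ?_⟩
        · rw [Finset.mem_singleton]
          exact (hlt k).ne
        · intro a ha _
          rw [Finset.mem_singleton.1 ha]
          exact hlt k
      · obtain ⟨X', hX', rfl⟩ := y.exists_mk
        obtain ⟨f, hf⟩ := Ind.mk_le_mk.1 hy.le
        have hfl : length X' < length X := Ind.length_strictMono hC hy
        obtain ⟨k, hk | hk⟩ := ih _ hfl hX' hW (fun k => f ≫ w k)
          (fun t ht => (cancel_mono f).1 (by
            rw [zero_comp]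
            exact hw _ fun k => by rw [Category.assoc]; exact ht k)) rfl
        · refine ⟨k, .inl ?_⟩
          rw [hμ]
          exact NatChain.insert_lt_of_lt hk fun a ha => (mem_measure_le hC ha).trans_lt (hlt k)
        · have hs : IsSplitMono f :=
            ⟨⟨⟨w k ≫ inv (f ≫ w k), by rw [← Category.assoc, IsIso.hom_inv_id]⟩⟩⟩
          have := isIso_of_isSplitMono f hX'.1 hX
          exact absurd (length_eq_of_iso (asIso f)) hfl.ne
    obtain ⟨k, hk⟩ := key
    have hmW := (D k.1).mono_ι k.2
    let m : W k ⟶ Y k.1 := (D k.1).ι k.2 ≫ image.ι (u k.1)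
    have hm : Mono m := mono_comp _ _
    have hle : Ind.mk (W k) (hW k) ≤ Ind.mk (Y k.1) (hY k.1) := Ind.mk_le_mk.2 ⟨m, hm⟩
    refine ⟨k.1, ?_⟩
    rcases hk with hk | hk
    · exact .inl (hk.trans_le (measure_mono hC hle))
    · have hXW : Ind.mk X hX = Ind.mk (W k) (hW k) := Ind.mk_eq_mk.2 ⟨asIso (w k)⟩
      by_cases hmi : IsIso m
      · right
        have hepi : Epi (image.ι (u k.1)) := epi_of_epi ((D k.1).ι k.2) _
        have hu : Epi (u k.1) := by
          rw [← image.fac (u k.1)]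
          infer_instance
        refine isIso_of_epi_of_length_le hC _ ?_
        rw [length_eq_of_iso (asIso (w k)), length_eq_of_iso (asIso m)]
      · left
        rw [hXW]
        refine measure_strictMono hC (lt_of_le_not_ge hle fun hge => ?_)
        exact (length_lt_of_mono hC m hmi).not_ge (Ind.length_mono hC hge)

end MainProperty

section Cogenerated

variable {C : Type u} [Category.{v} C] [Abelian C]

/-- `CogeneratedBy I A`: the object `A` embeds into a product of indecomposable objects of
Gabriel–Roiter measure at most `I`. -/
def CogeneratedBy (I : NatChain) (A : C) : Prop :=
  ∃ (ι : Type) (Y : ι → C) (hY : ∀ i, Indecomposable (Y i)) (u : ∀ i, A ⟶ Y i),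
    (∀ i, measure (Ind.mk (Y i) (hY i)) ≤ I) ∧
      ∀ (T : C) (t : T ⟶ A), (∀ i, t ≫ u i = 0) → t = 0

variable {I : NatChain}

theorem CogeneratedBy.of_mono {A B : C} (f : A ⟶ B) [Mono f] (hB : CogeneratedBy I B) :
    CogeneratedBy I A := by
  obtain ⟨ι, Y, hY, u, hle, hu⟩ := hB
  refine ⟨ι, Y, hY, fun i => f ≫ u i, hle, fun T t ht => (cancel_mono f).1 ?_⟩
  rw [zero_comp]
  exact hu T _ fun i => by rw [Category.assoc]; exact ht i

theorem CogeneratedBy.of_measure_le {A : C} (hA : Indecomposable A)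
    (h : measure (Ind.mk A hA) ≤ I) : CogeneratedBy I A :=
  ⟨Unit, fun _ => A, fun _ => hA, fun _ => 𝟙 A, fun _ => h,
    fun _ t ht => by simpa using ht ()⟩

theorem CogeneratedBy.measure_le (hC : IsLengthCategory C) {A : C} (h : CogeneratedBy I A)
    (hA : Indecomposable A) : measure (Ind.mk A hA) ≤ I := by
  obtain ⟨ι, Y, hY, u, hle, hu⟩ := h
  obtain ⟨i, hi | hi⟩ := exists_measure_lt_or_isIso hC hA hY u (fun t ht => hu _ t ht)
  · exact hi.le.trans (hle i)
  · rw [Ind.mk_eq_mk.2 ⟨asIso (u i)⟩]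
    exact hle i

theorem CogeneratedBy.of_isZero {A : C} (hA : IsZero A) : CogeneratedBy I A :=
  ⟨Empty, fun i => i.elim, fun i => i.elim, fun i => i.elim, fun i => i.elim,
    fun _ _ _ => hA.eq_of_tgt _ _⟩

theorem CogeneratedBy.biprod {A B : C} (hA : CogeneratedBy I A) (hB : CogeneratedBy I B) :
    CogeneratedBy I (A ⊞ B) := by
  obtain ⟨ι, Y, hY, u, hle, hu⟩ := hA
  obtain ⟨κ, Z, hZ, w, hle', hw⟩ := hB
  refine ⟨ι ⊕ κ, Sum.elim Y Z, Sum.rec hY hZ,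
    Sum.rec (fun i => biprod.fst ≫ u i) (fun j => biprod.snd ≫ w j), Sum.rec hle hle',
    fun T t ht => ?_⟩
  apply biprod.hom_ext
  · rw [zero_comp]
    exact hu T _ fun i => by rw [Category.assoc]; exact ht (.inl i)
  · rw [zero_comp]
    exact hw T _ fun j => by rw [Category.assoc]; exact ht (.inr j)

/-- Every object `Z` has a universal map to an object which embeds into a product of indecomposable
objects of measure at most `I`, namely the projection to the largest such quotient of `Z`. -/
theorem exists_largest_cogenerated_quotient (hC : IsLengthCategory C) (I : NatChain) (Z : C) :
    ∃ (Z' : C) (π : Z ⟶ Z'), CogeneratedBy I Z' ∧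
      ∀ (X : C) (f : Z ⟶ X), CogeneratedBy I X → ∃ g, π ≫ g = f := by
  let P : ℕ → Prop := fun n => ∃ (Z' : C) (π : Z ⟶ Z'), Epi π ∧ CogeneratedBy I Z' ∧ length Z' = n
  open ZeroObject in
  have h0 : P (length (0 : C)) :=
    ⟨0, 0, ⟨fun _ _ _ => Subsingleton.elim _ _⟩, .of_isZero (isZero_zero C), rfl⟩
  have hP : ∀ n, P n → n ≤ length Z := by
    rintro _ ⟨Z', π, hπ, -, rfl⟩
    exact length_le_of_epi hC π
  classical
  obtain ⟨Z', π, hπ, hZ', hl⟩ : P (Nat.findGreatest P (length Z)) :=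
    Nat.findGreatest_spec (hP _ h0) h0
  refine ⟨Z', π, hZ', fun X f hX => ?_⟩
  -- the image of `Z` in `Z' ⊞ X` cannot be larger than `Z'`
  let l : Z ⟶ Z' ⊞ X := biprod.lift π f
  let q : image l ⟶ Z' := image.ι l ≫ biprod.fst
  have hq : factorThruImage l ≫ q = π := by simp [q, l]
  have hqepi : Epi q := by
    have : Epi (factorThruImage l ≫ q) := by rwa [hq]
    exact epi_of_epi (factorThruImage l) q
  have hJ : P (length (image l)) :=
    ⟨image l, factorThruImage l, inferInstance, (hZ'.biprod hX).of_mono (image.ι l), rfl⟩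
  have hmax := Nat.le_findGreatest (hP _ hJ) hJ
  have hiso : IsIso q := isIso_of_epi_of_length_le hC q (hl ▸ hmax)
  refine ⟨inv q ≫ image.ι l ≫ biprod.snd, ?_⟩
  rw [← hq, Category.assoc, IsIso.hom_inv_id_assoc]
  simp [l]

end Cogenerated

section Finiteness

variable {C : Type u} [Category.{v} C] [Abelian C]

/-- A representative of a class in `ind C`. -/
noncomputable def Ind.rep (x : Ind C) : C :=
  x.exists_mk.choose

theorem Ind.indecomposable_rep (x : Ind C) : Indecomposable x.rep :=
  x.exists_mk.choose_spec.choose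

theorem Ind.mk_rep (x : Ind C) : Ind.mk x.rep x.indecomposable_rep = x :=
  x.exists_mk.choose_spec.choose_spec.symm

/-- In the class of objects of measure at most `I`, a left almost split map starting at `V` has
only finitely many indecomposable summands in its target, and every map from `V` which is not an
isomorphism to an indecomposable object passes through one of them. -/
theorem exists_finite_radical_step (hC : IsLengthCategory C) (I : NatChain) {V : C}
    (hV : Indecomposable V) {Y : C} {φ : V ⟶ Y} (hφ : IsLeftAlmostSplit φ) :
    ∃ T : Set (Ind C), T.Finite ∧ (∀ w ∈ T, measure w ≤ I) ∧
      ∀ {A X : C} (hX : Indecomposable X) (p : A ⟶ V) (h : V ⟶ X),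
        measure (Ind.mk X hX) ≤ I → ¬ IsIso h → p ≫ h ≠ 0 →
          ∃ w ∈ T, ∃ (g : V ⟶ w.rep) (h' : w.rep ⟶ X), ¬ IsIso g ∧ (p ≫ g) ≫ h' ≠ 0 := by
  obtain ⟨Z, π, hZ, huniv⟩ := exists_largest_cogenerated_quotient hC I Y
  let D := decomposition hC Z
  refine ⟨Set.range fun j => Ind.mk (D.obj j) (D.indecomposable j), Set.finite_range _, ?_, ?_⟩
  · rintro _ ⟨j, rfl⟩
    have := D.mono_ι j
    exact (hZ.of_mono (D.ι j)).measure_le hC _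
  · intro A X hX p h hμ hiso hne
    have hs : ¬ IsSplitMono h := fun hs => hiso (isIso_of_isSplitMono h hV.1 hX)
    obtain ⟨f, rfl⟩ := hφ.2 h hs
    obtain ⟨g, rfl⟩ := huniv X f (.of_measure_le hX hμ)
    obtain ⟨j, hj⟩ : ∃ j, p ≫ φ ≫ π ≫ D.π j ≫ D.ι j ≫ g ≠ 0 := by
      by_contra! hzero
      apply hne
      rw [D.eq_sum g]
      simp only [Preadditive.comp_sum]
      exact Finset.sum_eq_zero fun j _ => hzero j
    let w := Ind.mk (D.obj j) (D.indecomposable j)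
    obtain ⟨e⟩ := Ind.mk_eq_mk.1 w.mk_rep
    refine ⟨w, ⟨j, rfl⟩, φ ≫ π ≫ D.π j ≫ e.inv, e.hom ≫ D.ι j ≫ g, fun hg => hφ.1 ?_, ?_⟩
    · exact ⟨⟨⟨(π ≫ D.π j ≫ e.inv) ≫ inv (φ ≫ π ≫ D.π j ≫ e.inv), by
        rw [← Category.assoc, IsIso.hom_inv_id]⟩⟩⟩
    · simpa using hj

/-- The isomorphism classes of simple objects, as a subset of `ind C`. -/
def simpleInd (C : Type u) [Category.{v} C] [Abelian C] : Set (Ind C) :=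
  {x | Simple x.rep}

theorem finite_simpleInd (h : (simpleClasses C).Finite) : (simpleInd C).Finite := by
  let F : Ind C → Quotient (isIsomorphicSetoid C) := fun x => Quotient.mk _ x.rep
  have hF : Function.Injective F := by
    intro x y hxy
    rw [← x.mk_rep, ← y.mk_rep]
    exact Ind.mk_eq_mk.2 (Quotient.exact hxy)
  refine (h.preimage hF.injOn).subset fun x hx => ?_
  exact ⟨x.rep, hx, rfl⟩

theorem exists_simpleInd_le (hC : IsLengthCategory C) (x : Ind C) : ∃ s ∈ simpleInd C, s ≤ x := by
  obtain ⟨S, f, hS, hf⟩ := exists_mono_of_simple hC x.indecomposable_rep.1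
  let s := Ind.mk S (indecomposable_of_simple S)
  obtain ⟨e⟩ := Ind.mk_eq_mk.1 s.mk_rep
  refine ⟨s, Simple.of_iso e, ?_⟩
  rw [← x.mk_rep]
  exact Ind.mk_le_mk.2 ⟨f, hf⟩

/-- If the lengths of the indecomposable objects of measure at most `I` are bounded, then there are
only finitely many of them: by the Harada–Sai lemma each of them is reached from a simple object
by a bounded number of left almost split maps. -/
theorem finite_measure_le_of_length_le (hC : IsLengthCategory C)
    (hsimple : (simpleClasses C).Finite)
    (hsplit : ∀ X : C, Indecomposable X → ∃ (Y : C) (φ : X ⟶ Y), IsLeftAlmostSplit φ)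
    (I : NatChain) (b : ℕ) (hb : ∀ x : Ind C, measure x ≤ I → x.length ≤ b) :
    {x : Ind C | measure x ≤ I}.Finite := by
  have hstep := fun x : Ind C =>
    (hsplit x.rep x.indecomposable_rep).elim fun _ h => h.elim fun _ hφ =>
      exists_finite_radical_step hC I x.indecomposable_rep hφ
  choose N hNfin hNle hN using hstep
  -- the classes met after exactly `n` steps
  let T : ℕ → Set (Ind C) := fun n => Nat.rec (simpleInd C) (fun _ S => ⋃ x ∈ S, N x) n
  have hT : ∀ n, (T n).Finite := by
    intro n
    induction n with
    | zero => exact finite_simpleInd hsimple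
    | succ n ih => exact ih.biUnion fun x _ => hNfin x
  refine ((Set.finite_Iic (2 ^ b - 1)).biUnion fun n _ => hT n).subset fun x hx => ?_
  by_contra hcon
  simp only [Set.mem_iUnion, not_exists] at hcon
  have hμ : measure (Ind.mk x.rep x.indecomposable_rep) ≤ I := by rwa [x.mk_rep]
  have path : ∀ n ≤ 2 ^ b - 1, ∃ w ∈ T n, ∃ (A : C) (p : A ⟶ w.rep) (h : w.rep ⟶ x.rep),
      RadicalPath b n p ∧ p ≫ h ≠ 0 := by
    intro n
    induction n with
    | zero =>
      intro _
      obtain ⟨s, hs, hsx⟩ := exists_simpleInd_le hC x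
      have hsI : measure s ≤ I := (measure_mono hC hsx).trans hx
      rw [← s.mk_rep, ← x.mk_rep] at hsx
      obtain ⟨f, hf⟩ := Ind.mk_le_mk.1 hsx
      refine ⟨s, hs, s.rep, 𝟙 _, f, .nil s.indecomposable_rep ?_, fun h0 => ?_⟩
      · have := hb s hsI
        rwa [← s.mk_rep] at this
      · rw [Category.id_comp] at h0
        refine s.indecomposable_rep.1 ((IsZero.iff_id_eq_zero _).2 ((cancel_mono f).1 ?_))
        rw [h0, comp_zero, comp_zero]
    | succ n ih =>
      intro hn
      obtain ⟨w, hw, A, p, h, hp, hne⟩ := ih (by omega)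
      have hiso : ¬ IsIso h := by
        intro hiso
        refine hcon n (by simpa using by omega) ?_
        have hwx : Ind.mk w.rep w.indecomposable_rep = Ind.mk x.rep x.indecomposable_rep :=
          Ind.mk_eq_mk.2 ⟨asIso h⟩
        rw [w.mk_rep, x.mk_rep] at hwx
        exact hwx ▸ hw
      obtain ⟨w', hw', g, h', hg, hne'⟩ := hN w x.indecomposable_rep p h hμ hiso hne
      refine ⟨w', Set.mem_biUnion hw hw', A, p ≫ g, h', ?_, hne'⟩
      refine hp.snoc g w'.indecomposable_rep ?_ hg
      have := hb w' (hNle w w' hw')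
      rwa [← w'.mk_rep] at this
  obtain ⟨w, -, A, p, h, hp, hne⟩ := path _ le_rfl
  exact hne (by rw [hp.eq_zero hC, zero_comp])

end Finiteness

/-! ### The take-off part -/

section Enumeration

variable {C : Type u} [Category.{v} C] [Abelian C]

theorem length_and_measure_of_mem_simpleInd (hC : IsLengthCategory C) {s : Ind C}
    (hs : s ∈ simpleInd C) : s.length = 1 ∧ measure s = ⟨{1}⟩ := by
  have hs' : Simple s.rep := hs
  have hl : s.length = 1 := by
    rw [← s.mk_rep]
    exact length_eq_one_of_simple hC s.rep
  refine ⟨hl, ?_⟩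
  rcases measure_eq_singleton_or_insert hC s with h | ⟨y, hy, -⟩
  · rw [h, hl]
  · -- a proper subobject of a simple object would have length zero
    have hlt := Ind.length_strictMono hC hy
    have h0 : length y.rep = 0 := by
      have : (Ind.mk y.rep y.indecomposable_rep).length = 0 := by rw [y.mk_rep]; omega
      exact this
    exact absurd (isZero_of_length_eq_zero hC h0) y.indecomposable_rep.1

theorem measure_le_of_mem_simpleInd (hC : IsLengthCategory C) {s : Ind C} (hs : s ∈ simpleInd C)
    (x : Ind C) : measure s ≤ measure x := by
  obtain ⟨t, ht, htx⟩ := exists_simpleInd_le hC x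
  rw [(length_and_measure_of_mem_simpleInd hC hs).2, ← (length_and_measure_of_mem_simpleInd hC ht).2]
  exact measure_mono hC htx

theorem finite_measure_le_of_mem_simpleInd (hC : IsLengthCategory C)
    (hsimple : (simpleClasses C).Finite) {s : Ind C} (hs : s ∈ simpleInd C) :
    {y : Ind C | measure y ≤ measure s}.Finite := by
  refine (finite_simpleInd hsimple).subset fun y hy => ?_
  obtain ⟨t, ht, hty⟩ := exists_simpleInd_le hC y
  have hys := length_eq_of_measure_eq hC (le_antisymm hy (measure_le_of_mem_simpleInd hC hs y))
  have : t = y := Ind.eq_of_le_of_length_le hC hty (by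
    rw [hys, (length_and_measure_of_mem_simpleInd hC hs).1, (length_and_measure_of_mem_simpleInd hC ht).1])
  exact this ▸ ht

/-- Let `v` have maximal measure among the subobjects of `x` in `M`. The embedding of `v` into `x`
factors through the left almost split map starting at `v`, and the image of its target in `x` has a
summand of larger measure than `v`. That summand lies outside `M`, and its length is bounded in terms
of `M`. -/
theorem exists_le_notMem_length_le (hC : IsLengthCategory C)
    (hsplit : ∀ X : C, Indecomposable X → ∃ (Y : C) (φ : X ⟶ Y), IsLeftAlmostSplit φ)
    {M : Set (Ind C)} (hM : M.Finite) (hsub : simpleInd C ⊆ M) :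
    ∃ N : ℕ, ∀ x ∉ M, ∃ w ∉ M, w ≤ x ∧ w.length ≤ N := by
  choose Z φ hφ using fun x : Ind C => hsplit x.rep x.indecomposable_rep
  obtain ⟨N, hN⟩ := (hM.image fun v => length (Z v)).bddAbove
  refine ⟨N, fun x hx => ?_⟩
  obtain ⟨v, ⟨hvM, hvx⟩, hmax⟩ : ∃ v ∈ {v | v ∈ M ∧ v ≤ x},
      ∀ w ∈ {v | v ∈ M ∧ v ≤ x}, measure w ≤ measure v := by
    refine Set.exists_max_image _ measure (hM.subset fun v hv => hv.1) ?_
    obtain ⟨s, hs, hsx⟩ := exists_simpleInd_le hC x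
    exact ⟨s, hsub hs, hsx⟩
  have hvx' := hvx
  rw [← v.mk_rep, ← x.mk_rep] at hvx'
  obtain ⟨m, hm⟩ := Ind.mk_le_mk.1 hvx'
  have hs : ¬ IsSplitMono m := by
    intro hs
    have hiso := isIso_of_isSplitMono m v.indecomposable_rep.1 x.indecomposable_rep
    have : Ind.mk v.rep v.indecomposable_rep = Ind.mk x.rep x.indecomposable_rep :=
      Ind.mk_eq_mk.2 ⟨asIso m⟩
    rw [v.mk_rep, x.mk_rep] at this
    exact hx (this ▸ hvM)
  obtain ⟨f, rfl⟩ := (hφ v).2 m hs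
  let D := decomposition hC (image f)
  have hmono : Mono (φ v ≫ factorThruImage f) := by
    have : Mono ((φ v ≫ factorThruImage f) ≫ image.ι f) := by
      rwa [Category.assoc, image.fac]
    exact mono_of_mono _ (image.ι f)
  obtain ⟨j, hj⟩ := exists_measure_lt_or_isIso hC v.indecomposable_rep D.indecomposable
    (fun j => (φ v ≫ factorThruImage f) ≫ D.π j) (fun t ht => by
      rw [← cancel_mono (φ v ≫ factorThruImage f), zero_comp]
      exact D.eq_zero _ fun j => by rw [Category.assoc]; exact ht j)
  rw [v.mk_rep] at hj
  have hlt := hj.resolve_right fun hiso => (hφ v).1 ⟨⟨⟨(factorThruImage f ≫ D.π j) ≫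
    inv ((φ v ≫ factorThruImage f) ≫ D.π j), by
      rw [← Category.assoc, ← Category.assoc, IsIso.hom_inv_id]⟩⟩⟩
  have hι := D.mono_ι j
  have hle : Ind.mk (D.obj j) (D.indecomposable j) ≤ x := by
    refine le_trans ?_ x.mk_rep.le
    exact Ind.mk_le_mk.2 ⟨D.ι j ≫ image.ι f, mono_comp _ _⟩
  refine ⟨_, fun hmem => (hmax _ ⟨hmem, hle⟩).not_gt hlt, hle, ?_⟩
  calc length (D.obj j) ≤ length (image f) := length_le_of_mono hC (D.ι j)
    _ ≤ length (Z v) := length_image_le hC f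
    _ ≤ N := hN ⟨v, hvM, rfl⟩

theorem exists_minimal_measure_notMem (hC : IsLengthCategory C)
    (hsplit : ∀ X : C, Indecomposable X → ∃ (Y : C) (φ : X ⟶ Y), IsLeftAlmostSplit φ)
    {M : Set (Ind C)} (hM : M.Finite) (hsub : simpleInd C ⊆ M) (hne : ∃ x, x ∉ M) :
    ∃ w ∉ M, ∀ x ∉ M, measure w ≤ measure x := by
  obtain ⟨N, hN⟩ := exists_le_notMem_length_le hC hsplit hM hsub
  let S : Set NatChain := {I | ∃ w ∉ M, w.length ≤ N ∧ measure w = I}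
  have hS : S.Finite := by
    refine (NatChain.finite_of_bounded N).subset ?_
    rintro _ ⟨w, -, hw, rfl⟩ a ha
    exact (mem_measure_le hC ha).trans hw
  obtain ⟨x₀, hx₀⟩ := hne
  obtain ⟨w₀, hw₀, -, hl₀⟩ := hN x₀ hx₀
  obtain ⟨_, ⟨w, hw, -, rfl⟩, hmin⟩ := Set.exists_min_image S id hS ⟨_, w₀, hw₀, hl₀, rfl⟩
  refine ⟨w, hw, fun x hx => ?_⟩
  obtain ⟨y, hy, hyx, hl⟩ := hN x hx
  exact (hmin _ ⟨y, hy, hl, rfl⟩).trans (measure_mono hC hyx)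

variable (C) in
/-- The classes `x` such that only finitely many classes have a measure not exceeding that of `x`
(the take-off part of `ind C`). -/
def takeOff : Set (Ind C) :=
  {x | {y : Ind C | measure y ≤ measure x}.Finite}

theorem mem_takeOff_of_measure_le {x y : Ind C} (hx : x ∈ takeOff C)
    (h : measure y ≤ measure x) : y ∈ takeOff C :=
  Set.Finite.subset hx fun _ hz => le_trans hz h

theorem infinite_takeOff (hC : IsLengthCategory C) (hind : Infinite (Ind C))
    (hsimple : (simpleClasses C).Finite)
    (hsplit : ∀ X : C, Indecomposable X → ∃ (Y : C) (φ : X ⟶ Y), IsLeftAlmostSplit φ) :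
    (takeOff C).Infinite := by
  intro hfin
  obtain ⟨w, hw, hmin⟩ := exists_minimal_measure_notMem hC hsplit hfin
    (fun s hs => finite_measure_le_of_mem_simpleInd hC hsimple hs) hfin.exists_notMem
  obtain ⟨N, hN⟩ := (hfin.image Ind.length).bddAbove
  refine hw (finite_measure_le_of_length_le hC hsimple hsplit _ (max N w.length) fun x hx => ?_)
  by_cases hxt : x ∈ takeOff C
  · exact le_max_of_le_left (hN ⟨x, hxt, rfl⟩)
  · exact le_max_of_le_right (length_eq_of_measure_eq hC (le_antisymm hx (hmin x hxt))).le

end Enumeration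

/-- An infinite subset of a linear order all of whose initial segments are finite is the range of a
strictly increasing sequence. -/
theorem exists_strictMono_range_eq {α : Type*} [LinearOrder α] {S : Set α} (hS : S.Infinite)
    (hfin : ∀ a ∈ S, {b ∈ S | b ≤ a}.Finite) :
    ∃ f : ℕ → α, StrictMono f ∧ Set.range f = S := by
  have hIic : ∀ a : S, (Set.Iic a).Finite := fun a =>
    Set.Finite.of_finite_image
      ((hfin a a.2).subset (by rintro _ ⟨b, hb, rfl⟩; exact ⟨b.2, hb⟩))
      Subtype.val_injective.injOn
  obtain ⟨a₀, ha₀⟩ := hS.nonempty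
  obtain ⟨m, hm, hmin⟩ := Set.exists_min_image _ id (hIic ⟨a₀, ha₀⟩) ⟨_, le_rfl⟩
  let _ : LocallyFiniteOrder S := .ofFiniteIcc fun a b => (hIic b).subset fun _ h => h.2
  let _ : OrderBot S :=
    { bot := m
      bot_le := fun b => (le_total b ⟨a₀, ha₀⟩).elim (hmin b) fun h => le_trans hm h }
  have _ : NoMaxOrder S := ⟨fun a => by
    have := hS.to_subtype
    obtain ⟨b, hb⟩ := (hIic a).exists_notMem
    exact ⟨b, not_le.1 hb⟩⟩
  let _ : SuccOrder S := LinearLocallyFiniteOrder.succOrder S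
  let _ : PredOrder S := LinearLocallyFiniteOrder.predOrder S
  let e : S ≃o ℕ := orderIsoNatOfLinearSuccPredArch
  refine ⟨fun n => e.symm n, fun a b h => e.symm.strictMono h, ?_⟩
  ext a
  constructor
  · rintro ⟨n, rfl⟩
    exact (e.symm n).2
  · intro ha
    exact ⟨e ⟨a, ha⟩, by simp⟩

end GabrielRoiter

theorem theorem4p5 {C : Type u} [Category.{v} C] [Abelian C]
    (hlength : GabrielRoiter.IsLengthCategory C)
    (hind : Infinite (GabrielRoiter.Ind C))
    (hsimple : (GabrielRoiter.simpleClasses C).Finite)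
    (hsplit : ∀ X : C, Indecomposable X →
      ∃ (Y : C) (φ : X ⟶ Y), GabrielRoiter.IsLeftAlmostSplit φ) :
    ∃ X : ℕ → GabrielRoiter.Ind C,
      (∀ i, GabrielRoiter.measure (X i) < GabrielRoiter.measure (X (i + 1))) ∧
      (∀ Y : GabrielRoiter.Ind C,
        (∀ i, GabrielRoiter.measure Y ≠ GabrielRoiter.measure (X i)) →
          ∀ i, GabrielRoiter.measure (X i) < GabrielRoiter.measure Y) ∧
      (∀ i, {Y : GabrielRoiter.Ind C |
        GabrielRoiter.measure Y = GabrielRoiter.measure (X i)}.Finite) := by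
  have hinf := GabrielRoiter.infinite_takeOff hlength hind hsimple hsplit
  -- the values of the measure on the take-off part: fibres and initial segments are finite
  have hvals : (GabrielRoiter.measure '' GabrielRoiter.takeOff C).Infinite := by
    intro hfin
    refine hinf (hfin.preimage' ?_ |>.subset (Set.subset_preimage_image _ _))
    rintro _ ⟨x, hx, rfl⟩
    exact Set.Finite.subset hx fun y hy => le_of_eq hy
  obtain ⟨f, hf, hrange⟩ := GabrielRoiter.exists_strictMono_range_eq hvals (by
    rintro _ ⟨x, hx, rfl⟩
    refine (Set.Finite.image GabrielRoiter.measure hx).subset ?_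
    rintro _ ⟨⟨y, -, rfl⟩, hy⟩
    exact ⟨y, hy, rfl⟩)
  have hmem : ∀ i, ∃ x ∈ GabrielRoiter.takeOff C, GabrielRoiter.measure x = f i := fun i => by
    have := Set.mem_range_self (f := f) i
    rwa [hrange] at this
  choose X hX hXf using hmem
  refine ⟨X, fun i => ?_, fun Y hY i => ?_, fun i => ?_⟩
  · rw [hXf, hXf]
    exact hf i.lt_succ_self
  · by_contra hle
    have hYt := GabrielRoiter.mem_takeOff_of_measure_le (hX i) (not_lt.1 hle)
    have hYr : GabrielRoiter.measure Y ∈ Set.range f := hrange ▸ ⟨Y, hYt, rfl⟩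
    obtain ⟨j, hj⟩ := hYr
    exact hY j (by rw [hXf, hj])
  · exact Set.Finite.subset (hX i) fun Y hY => le_of_eq hY
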